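/- Let $(\Omega,\mathcal F,(\mathcal F_t)_{t\ge 0},\mathbb P)$ be a filtered probability space. A set $A\subset\Omega$ is called N-negligible if there are sets $B_n\in\mathcal F_n$, $n=0,1,2,\dots$, with $\mathbb P[B_n]=0$ and $A\subset\bigcup_{n\ge 0}B_n$. Assume that the space satisfies the N-usual conditions, i.e. every N-negligible set belongs to $\mathcal F_0$ and $(\mathcal F_t)_{t\ge 0}$ is right-continuous ($\mathcal F_t=\bigcap_{u>t}\mathcal F_u$ for all $t\ge 0$). Let $(X_t)_{t\ge 0}$ be a real-valued submartingale or supermartingale with respect to $(\mathcal F_t)_{t\ge0}$ and $\mathbb P$ such that $t\mapsto\mathbb E[X_t]$ is right-continuous (in particular, $(X_t)_{t\ge 0}$ may be any martingale). Then $(X_t)_{t\ge0}$ admits an adapted càdlàg modification: there is an $(\mathcal F_t)$-adapted process $(Y_t)_{t\ge0}$, all of whose paths are right-continuous with finite left limits, such that $Y_t=X_t$ almost surely for each $t\ge 0$. This modification is unique up to indistinguishability: if $Y$ and $Z$ are càdlàg modifications of $X$ (adapted or not), then almost surely $Y_t=Z_t$ for all $t\ge0$. -/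

import Mathlib

open MeasureTheory Filter
open scoped NNReal Topology

namespace NAugmentation

variable {Ω : Type*} {mΩ : MeasurableSpace Ω}

/-- A subset `A` of `Ω` is N-negligible if it is contained in a countable union of null sets
`B n` such that `B n` belongs to `𝓕 n` for every integer `n ≥ 0`. -/
def NNegligible (𝓕 : Filtration ℝ≥0 mΩ) (P : Measure Ω) (A : Set Ω) : Prop :=
  ∃ B : ℕ → Set Ω, (∀ n : ℕ, MeasurableSet[𝓕 (n : ℝ≥0)] (B n) ∧ P (B n) = 0) ∧ A ⊆ ⋃ n, B n

/-- The filtered probability space is N-complete if `𝓕 0` contains all N-negligible sets. -/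
def NComplete (𝓕 : Filtration ℝ≥0 mΩ) (P : Measure Ω) : Prop :=
  ∀ A : Set Ω, NNegligible 𝓕 P A → MeasurableSet[𝓕 0] A

/-- The N-usual conditions: N-completeness and right-continuity of the filtration. -/
structure NUsualConditions (𝓕 : Filtration ℝ≥0 mΩ) (P : Measure Ω) : Prop where
  nComplete : NComplete 𝓕 P
  rightContinuous : 𝓕.IsRightContinuous

/-- A path is càdlàg if it is right-continuous with a finite left limit at every time
(at time `0` the condition on left limits is void, since `𝓝[<] 0 = ⊥` in `ℝ≥0`). -/
def IsCadlag (f : ℝ≥0 → ℝ) : Prop :=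
  ∀ t, ContinuousWithinAt f (Set.Ici t) t ∧ ∃ l : ℝ, Tendsto f (𝓝[<] t) (𝓝 l)

/-- `Y` is a modification of `X`: for every time `t`, almost surely `Y t = X t`. -/
def IsModification (P : Measure Ω) (Y X : ℝ≥0 → Ω → ℝ) : Prop :=
  ∀ t, ∀ᵐ ω ∂P, Y t ω = X t ω

/-- `Y` and `Z` are indistinguishable: almost surely, `Y t = Z t` for all times `t`. -/
def Indistinguishable (P : Measure Ω) (Y Z : ℝ≥0 → Ω → ℝ) : Prop :=
  ∀ᵐ ω ∂P, ∀ t, Y t ω = Z t ω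

/-- `Y` is a modification of `X` all of whose paths are càdlàg. -/
def IsCadlagModification (P : Measure Ω) (Y X : ℝ≥0 → Ω → ℝ) : Prop :=
  IsModification P Y X ∧ ∀ ω, IsCadlag (fun t => Y t ω)

end NAugmentation

/-! The classical regularisation works because the exceptional set can be taken N-negligible, not
merely null. For each integer `N`, Doob's maximal and upcrossing inequalities on finite grids in
`[0, N]`, with bounds independent of the mesh, give a null event of `𝓕 N` off which the path on
rationals up to `N` is bounded with finitely many upcrossings of each rational interval
(`exists_null_isTameUpTo`). The union over `N` is N-negligible, hence in `𝓕 0`.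

Off this union, one-sided limits along rationals exist. Let `Y t` be the right limit, and `0` on the
union: its paths are càdlàg, and right-continuity of `𝓕` makes it adapted. Right-continuity of the
mean gives uniform integrability along times decreasing to `t`, so convergence is in L¹; then `X t ≤
Y t` a.s. with equal means, hence equality (`ae_eq_of_tendsto_nhdsGT`). Supermartingales follow by
negation; martingales have constant mean. -/

namespace NAugmentation

/-! ### Upcrossings and one-sided limits of deterministic paths. -/

section Paths

/-- `UpcrossingChain a b g n u v` says that between the times `u` and `v` the path `g` passes at
least `n` times from values `≤ a` to values `≥ b`. -/
def UpcrossingChain {ι : Type*} [Preorder ι] (a b : ℝ) (g : ι → ℝ) : ℕ → ι → ι → Prop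
  | 0, u, v => u ≤ v
  | n + 1, u, v => ∃ s t, u ≤ s ∧ s ≤ t ∧ g s ≤ a ∧ b ≤ g t ∧ UpcrossingChain a b g n t v

variable {ι κ : Type*} [Preorder ι] [Preorder κ] {a b : ℝ} {g : ι → ℝ}

theorem UpcrossingChain.le {n : ℕ} {u v : ι} (h : UpcrossingChain a b g n u v) : u ≤ v := by
  induction n generalizing u with
  | zero => exact h
  | succ n ih =>
    obtain ⟨s, t, hs, hst, -, -, h⟩ := h
    exact hs.trans (hst.trans (ih h))

theorem UpcrossingChain.mono_left {n : ℕ} {u u' v : ι} (hu : u' ≤ u)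
    (h : UpcrossingChain a b g n u v) : UpcrossingChain a b g n u' v := by
  cases n with
  | zero => exact hu.trans h
  | succ n =>
    obtain ⟨s, t, hs, h⟩ := h
    exact ⟨s, t, hu.trans hs, h⟩

/-- Upcrossing chains are transported along monotone time changes that eventually preserve the
values of the path. -/
theorem UpcrossingChain.eventually_map {e : ℕ → ι → κ} (he : ∀ k, Monotone (e k))
    {f : ℕ → κ → ℝ} {n : ℕ} {u v : ι} (hf : ∀ s ≤ v, ∀ᶠ k in atTop, f k (e k s) = g s)
    (h : UpcrossingChain a b g n u v) :
    ∀ᶠ k in atTop, UpcrossingChain a b (f k) n (e k u) (e k v) := by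
  induction n generalizing u with
  | zero => exact Eventually.of_forall fun k => he k h
  | succ n ih =>
    obtain ⟨s, t, hs, hst, hsa, htb, h⟩ := h
    filter_upwards [ih h, hf s (hst.trans h.le), hf t h.le] with k hk hks hkt
    exact ⟨e k s, e k t, he k hs, he k hst, hks.trans_le hsa, htb.trans_eq hkt.symm, hk⟩

/-- A chain of `n` upcrossings before `j` forces the `n`-th upper crossing time to be at
most `j`. -/
theorem UpcrossingChain.upperCrossingTime_le {Ω : Type*} {f : ℕ → Ω → ℝ} {ω : Ω} {M m n i j : ℕ}
    (hj : j ≤ M) (h : UpcrossingChain a b (fun k => f k ω) n i j)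
    (hm : upperCrossingTime a b f M m ω ≤ i) : upperCrossingTime a b f M (m + n) ω ≤ j := by
  induction n generalizing i m with
  | zero => exact hm.trans h
  | succ n ih =>
    obtain ⟨s, t, hs, hst, hsa, htb, h⟩ := h
    rw [← Nat.succ_add_eq_add_succ]
    refine ih h ?_
    rw [Nat.succ_eq_add_one, upperCrossingTime_succ_eq]
    -- Hitting times are earliest, so the greedy crossing ends no later than the pair `s`, `t` of
    -- the chain.
    refine hittingBtwn_le_of_mem (le_trans ?_ hst) (h.le.trans hj) htb
    exact hittingBtwn_le_of_mem (hm.trans hs) (hst.trans (h.le.trans hj)) hsa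

/-- The filter of rational times strictly decreasing to `t`. -/
def rightRat (t : ℝ≥0) : Filter ℚ≥0 := comap (fun q : ℚ≥0 => (q : ℝ≥0)) (𝓝[>] t)

/-- The filter of rational times strictly increasing to `t`. -/
def leftRat (t : ℝ≥0) : Filter ℚ≥0 := comap (fun q : ℚ≥0 => (q : ℝ≥0)) (𝓝[<] t)

theorem exists_nnrat_btwn {x y : ℝ≥0} (h : x < y) : ∃ q : ℚ≥0, x < (q : ℝ≥0) ∧ (q : ℝ≥0) < y := by
  obtain ⟨q, hq0, h1, h2⟩ := NNReal.lt_iff_exists_rat_btwn x y |>.1 h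
  lift q to ℚ≥0 using hq0
  have e : Real.toNNReal ((q : ℚ) : ℝ) = (q : ℝ≥0) := by
    rw [← NNReal.coe_inj, Real.coe_toNNReal _ (by positivity)]
    rfl
  rw [e] at h1 h2
  exact ⟨q, h1, h2⟩

theorem eventually_rightRat {t : ℝ≥0} {p : ℚ≥0 → Prop} :
    (∀ᶠ q in rightRat t, p q) ↔ ∃ u > t, ∀ q : ℚ≥0, t < q → (q : ℝ≥0) < u → p q := by
  rw [rightRat, ((nhdsGT_basis t).comap _).eventually_iff]
  simp [Set.mem_Ioo]

theorem eventually_leftRat {t : ℝ≥0} (ht : 0 < t) {p : ℚ≥0 → Prop} :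
    (∀ᶠ q in leftRat t, p q) ↔ ∃ u < t, ∀ q : ℚ≥0, u < q → (q : ℝ≥0) < t → p q := by
  rw [leftRat, ((nhdsLT_basis_of_exists_lt ⟨0, ht⟩).comap _).eventually_iff]
  simp [Set.mem_Ioo]

theorem frequently_rightRat {t : ℝ≥0} {p : ℚ≥0 → Prop} :
    (∃ᶠ q in rightRat t, p q) ↔ ∀ u > t, ∃ q : ℚ≥0, t < q ∧ (q : ℝ≥0) < u ∧ p q := by
  rw [Filter.Frequently, eventually_rightRat]
  push Not
  rfl

theorem frequently_leftRat {t : ℝ≥0} (ht : 0 < t) {p : ℚ≥0 → Prop} :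
    (∃ᶠ q in leftRat t, p q) ↔ ∀ u < t, ∃ q : ℚ≥0, u < q ∧ (q : ℝ≥0) < t ∧ p q := by
  rw [Filter.Frequently, eventually_leftRat ht]
  push Not
  rfl

instance rightRat_neBot (t : ℝ≥0) : (rightRat t).NeBot := by
  rw [← frequently_true_iff_neBot, frequently_rightRat]
  intro u hu
  obtain ⟨q, h1, h2⟩ := exists_nnrat_btwn hu
  exact ⟨q, h1, h2, trivial⟩

instance rightRat_isCountablyGenerated (t : ℝ≥0) : (rightRat t).IsCountablyGenerated := by
  unfold rightRat; infer_instance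

theorem leftRat_zero : leftRat 0 = ⊥ := by
  have : 𝓝[<] (0 : ℝ≥0) = ⊥ := by
    rw [show Set.Iio (0 : ℝ≥0) = ∅ from Set.Iio_bot, nhdsWithin_empty]
  rw [leftRat, this, comap_bot]

/-- The chain grows backwards: each new upcrossing is prepended strictly between `t` and the current
start. -/
theorem exists_upcrossingChain_of_frequently_rightRat {g : ℚ≥0 → ℝ} {t : ℝ≥0}
    (ha : ∃ᶠ q in rightRat t, g q < a) (hb : ∃ᶠ q in rightRat t, b < g q) (n : ℕ) {v : ℚ≥0}
    (hv : t < v) : ∃ u : ℚ≥0, t < u ∧ UpcrossingChain a b g n u v := by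
  rw [frequently_rightRat] at ha hb
  induction n with
  | zero => exact ⟨v, hv, le_rfl⟩
  | succ n ih =>
    obtain ⟨u, hu, h⟩ := ih
    obtain ⟨q, hq, hqu, hqb⟩ := hb u hu
    obtain ⟨p, hp, hpq, hpa⟩ := ha q hq
    exact ⟨p, hp, p, q, le_rfl, by exact_mod_cast hpq.le, hpa.le, hqb.le,
      h.mono_left (by exact_mod_cast hqu.le)⟩

theorem exists_upcrossingChain_of_frequently_leftRat {g : ℚ≥0 → ℝ} {t : ℝ≥0} (ht : 0 < t)
    (ha : ∃ᶠ q in leftRat t, g q < a) (hb : ∃ᶠ q in leftRat t, b < g q) (n : ℕ) {u : ℚ≥0}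
    (hu : u < t) : ∃ v : ℚ≥0, v < t ∧ UpcrossingChain a b g n u v := by
  rw [frequently_leftRat ht] at ha hb
  induction n generalizing u with
  | zero => exact ⟨u, hu, le_rfl⟩
  | succ n ih =>
    obtain ⟨p, hp, hpt, hpa⟩ := ha u hu
    obtain ⟨q, hq, hqt, hqb⟩ := hb p hpt
    obtain ⟨v, hv, h⟩ := ih hqt
    exact ⟨v, hv, p, q, by exact_mod_cast hp.le, by exact_mod_cast hq.le, hpa.le, hqb.le, h⟩

/-- Up to time `N`, the path `g` on the rationals is bounded and has finitely many upcrossings of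
every interval with rational endpoints. -/
structure IsTameUpTo (g : ℚ≥0 → ℝ) (N : ℕ) : Prop where
  bounded : ∃ C : ℝ, ∀ q : ℚ≥0, (q : ℝ≥0) ≤ N → |g q| ≤ C
  upcrossings : ∀ a b : ℚ, a < b →
    ∃ n, ∀ u v : ℚ≥0, (v : ℝ≥0) ≤ N → ¬ UpcrossingChain (a : ℝ) b g n u v

/-- Without a limit, a bounded path oscillates across some rational interval; `H` turns oscillation
into arbitrarily many upcrossings. -/
theorem IsTameUpTo.exists_tendsto {g : ℚ≥0 → ℝ} {N : ℕ} (h : IsTameUpTo g N) {l : Filter ℚ≥0}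
    (hl : ∀ᶠ q : ℚ≥0 in l, (q : ℝ≥0) ≤ N)
    (H : ∀ a b : ℝ, (∃ᶠ q in l, g q < a) → (∃ᶠ q in l, b < g q) → ∀ n,
      ∃ u v : ℚ≥0, (v : ℝ≥0) ≤ N ∧ UpcrossingChain a b g n u v) :
    ∃ c : ℝ, Tendsto g l (𝓝 c) := by
  obtain ⟨C, hC⟩ := h.bounded
  refine tendsto_of_no_upcrossings Rat.isDenseEmbedding_coe_real.dense ?_ ?_ ?_
  · rintro _ ⟨a, rfl⟩ _ ⟨b, rfl⟩ hab ⟨ha, hb⟩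
    obtain ⟨n, hn⟩ := h.upcrossings a b (by exact_mod_cast hab)
    obtain ⟨u, v, hv, hc⟩ := H a b ha hb n
    exact hn u v hv hc
  · exact isBoundedUnder_of_eventually_le (a := C)
      (hl.mono fun q hq => (abs_le.1 (hC q hq)).2)
  · exact isBoundedUnder_of_eventually_ge (a := -C)
      (hl.mono fun q hq => (abs_le.1 (hC q hq)).1)

theorem exists_tendsto_rightRat {g : ℚ≥0 → ℝ} (h : ∀ N, IsTameUpTo g N) (t : ℝ≥0) :
    ∃ c : ℝ, Tendsto g (rightRat t) (𝓝 c) := by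
  obtain ⟨N, hN⟩ := exists_nat_gt t
  refine (h N).exists_tendsto (eventually_rightRat.2 ⟨N, hN, fun q _ hq => hq.le⟩) ?_
  intro a b ha hb n
  obtain ⟨v, hv, hvN⟩ := exists_nnrat_btwn hN
  obtain ⟨u, -, hu⟩ := exists_upcrossingChain_of_frequently_rightRat ha hb n hv
  exact ⟨u, v, hvN.le, hu⟩

theorem exists_tendsto_leftRat {g : ℚ≥0 → ℝ} (h : ∀ N, IsTameUpTo g N) (t : ℝ≥0) :
    ∃ c : ℝ, Tendsto g (leftRat t) (𝓝 c) := by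
  rcases eq_zero_or_pos t with rfl | ht
  · exact ⟨0, by rw [leftRat_zero]; exact tendsto_bot⟩
  obtain ⟨N, hN⟩ := exists_nat_gt t
  refine (h N).exists_tendsto
    ((eventually_leftRat ht).2 ⟨0, ht, fun q _ hq => (hq.trans hN).le⟩) ?_
  intro a b ha hb n
  obtain ⟨v, hv, hc⟩ :=
    exists_upcrossingChain_of_frequently_leftRat ht ha hb n (u := 0) (by exact_mod_cast ht)
  exact ⟨0, v, (hv.trans hN).le, hc⟩

theorem mem_of_tendsto_rightRat {g : ℚ≥0 → ℝ} {r : ℝ≥0 → ℝ}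
    (hr : ∀ t, Tendsto g (rightRat t) (𝓝 (r t))) {V : Set ℝ} (hV : IsClosed V) {x y s : ℝ≥0}
    (h : ∀ q : ℚ≥0, x < q → (q : ℝ≥0) < y → g q ∈ V) (hxs : x ≤ s) (hsy : s < y) : r s ∈ V :=
  hV.mem_of_tendsto (hr s)
    (eventually_rightRat.2 ⟨y, hsy, fun q hsq hqy => h q (hxs.trans_lt hsq) hqy⟩)

/-- If a path on the rationals has one-sided limits everywhere, then its right limits form a
càdlàg path. -/
theorem isCadlag_of_tendsto_rightRat {g : ℚ≥0 → ℝ} {r : ℝ≥0 → ℝ}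
    (hr : ∀ t, Tendsto g (rightRat t) (𝓝 (r t)))
    (hl : ∀ t, ∃ c : ℝ, Tendsto g (leftRat t) (𝓝 c)) : IsCadlag r := by
  intro t
  constructor
  -- Closed neighbourhoods are used because `r s`, a limit of values of `g` in `V`, then stays in
  -- `V`.
  · refine (closed_nhds_basis (r t)).tendsto_right_iff.2 fun V hV => ?_
    obtain ⟨u, hu, h⟩ := eventually_rightRat.1 ((hr t).eventually_mem hV.1)
    filter_upwards [Ico_mem_nhdsGE hu] with s hs
    exact mem_of_tendsto_rightRat hr hV.2 h hs.1 hs.2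
  · obtain ⟨c, hc⟩ := hl t
    refine ⟨c, (closed_nhds_basis c).tendsto_right_iff.2 fun V hV => ?_⟩
    rcases eq_zero_or_pos t with rfl | ht
    · rw [show Set.Iio (0 : ℝ≥0) = ∅ from Set.Iio_bot, nhdsWithin_empty]
      exact eventually_bot
    obtain ⟨u, hu, h⟩ := (eventually_leftRat ht).1 (hc.eventually_mem hV.1)
    filter_upwards [Ioo_mem_nhdsLT hu] with s hs
    exact mem_of_tendsto_rightRat hr hV.2 h hs.1.le hs.2

/-- Càdlàg paths that agree at all rational times agree. -/
theorem IsCadlag.eq_of_forall_nnrat {f g : ℝ≥0 → ℝ} (hf : IsCadlag f) (hg : IsCadlag g)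
    (h : ∀ q : ℚ≥0, f q = g q) (t : ℝ≥0) : f t = g t := by
  have hle : Tendsto (fun q : ℚ≥0 => (q : ℝ≥0)) (rightRat t) (𝓝[≥] t) :=
    tendsto_comap.mono_right (nhdsWithin_mono t Set.Ioi_subset_Ici_self)
  refine tendsto_nhds_unique ((hf t).1.tendsto.comp hle) ?_
  exact ((hg t).1.tendsto.comp hle).congr fun q => (h q).symm

end Paths

/-! ### Maximal and upcrossing inequalities in discrete time. -/

section Discrete

variable {Ω : Type*} {mΩ : MeasurableSpace Ω} {P : Measure Ω} [IsFiniteMeasure P]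
  {𝓖 : Filtration ℕ mΩ} {f : ℕ → Ω → ℝ}

/-- Markov's inequality for the number of upcrossings of a discrete submartingale. -/
theorem mul_measureReal_upperCrossingTime_lt_le (hf : Submartingale f 𝓖 P) {a b : ℝ}
    (hab : a < b) (M n : ℕ) :
    n * P.real {ω | upperCrossingTime a b f M n ω < M} ≤
      (∫ ω, (f M ω - a)⁺ ∂P) / (b - a) := by
  rw [le_div_iff₀ (sub_pos.2 hab), mul_comm]
  refine le_trans ?_ (hf.mul_integral_upcrossingsBefore_le_integral_pos_part a b M)
  refine mul_le_mul_of_nonneg_left ?_ (sub_pos.2 hab).le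
  refine le_trans ?_ (mul_meas_ge_le_integral_of_nonneg (ae_of_all _ fun ω => Nat.cast_nonneg _)
    (hf.stronglyAdapted.integrable_upcrossingsBefore hab) (n : ℝ))
  refine mul_le_mul_of_nonneg_left (measureReal_mono fun ω hω => ?_) (Nat.cast_nonneg _)
  by_contra h
  have h' : upcrossingsBefore a b f M ω < n := by
    simpa only [Set.mem_ofPred_eq, Nat.cast_le, not_le] using h
  exact (upperCrossingTime_eq_of_upcrossingsBefore_lt hab h').not_lt hω

theorem mul_measureReal_exists_le_le (hf : Submartingale f 𝓖 P) (c : ℝ≥0) (M : ℕ) :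
    c * P.real {ω | ∃ i ≤ M, (c : ℝ) ≤ f i ω} ≤ ∫ ω, (f M ω)⁺ ∂P := by
  have hpos := hf.pos
  have h := maximal_ineq hpos (fun i ω => posPart_nonneg (f i ω)) (ε := c) M
  have hint : Integrable (fun ω => (f M ω)⁺) P := hpos.integrable M
  have h2 := h.trans (ENNReal.ofReal_le_ofReal
    (setIntegral_le_integral hint (ae_of_all _ fun ω => posPart_nonneg (f M ω))))
  have h3 := ENNReal.toReal_le_of_le_ofReal (integral_nonneg fun ω => posPart_nonneg (f M ω)) h2
  rw [ENNReal.toReal_mul, ENNReal.coe_toReal] at h3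
  refine le_trans (mul_le_mul_of_nonneg_left (measureReal_mono ?_) c.2) h3
  rintro ω ⟨i, hi, h⟩
  refine (h.trans (le_posPart _)).trans ?_
  exact Finset.le_sup' (fun k => (f⁺) k ω) (Finset.mem_range_succ_iff.2 hi)

/-- Stop at the first value `≤ -c`, or at `M`. The stopped value is at most `(f M)⁺ - c` on `S` and
equals `f M` off `S`, while its mean is at least that of `f 0`. -/
theorem mul_measureReal_exists_le_neg_le (hf : Submartingale f 𝓖 P) (c : ℝ≥0) (M : ℕ) :
    c * P.real {ω | ∃ i ≤ M, f i ω ≤ -(c : ℝ)} ≤ ∫ ω, (f M ω)⁺ ∂P - ∫ ω, f 0 ω ∂P := by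
  set S := {ω | ∃ i ≤ M, f i ω ≤ -(c : ℝ)} with hS
  have hSm : MeasurableSet S := by
    have : S = ⋃ i ∈ Set.Iic M, {ω | f i ω ≤ -(c : ℝ)} := by ext; simp [hS]
    rw [this]
    exact MeasurableSet.biUnion (Set.to_countable _) fun i _ =>
      measurableSet_le ((hf.stronglyMeasurable i).mono (𝓖.le i)).measurable measurable_const
  have hτ : IsStoppingTime 𝓖 (fun ω => (hittingBtwn f (Set.Iic (-(c : ℝ))) 0 M ω : ℕ)) :=
    hf.stronglyAdapted.adapted.isStoppingTime_hittingBtwn measurableSet_Iic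
  have hτM : ∀ ω, ((hittingBtwn f (Set.Iic (-(c : ℝ))) 0 M ω : ℕ) : WithTop ℕ) ≤ (M : ℕ) :=
    fun ω => WithTop.coe_le_coe.2 (hittingBtwn_le ω)
  have h0 : ∫ ω, f 0 ω ∂P ≤
      ∫ ω, stoppedValue f (fun ω => (hittingBtwn f (Set.Iic (-(c : ℝ))) 0 M ω : ℕ)) ω ∂P :=
    hf.expected_stoppedValue_mono (isStoppingTime_const 𝓖 0) hτ
      (fun ω => WithTop.coe_le_coe.2 (Nat.zero_le _)) hτM
  have hint : Integrable (fun ω => (f M ω)⁺) P := hf.pos.integrable M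
  have h1 : ∫ ω, stoppedValue f (fun ω => (hittingBtwn f (Set.Iic (-(c : ℝ))) 0 M ω : ℕ)) ω ∂P ≤
      ∫ ω, ((f M ω)⁺ - S.indicator (fun _ => (c : ℝ)) ω) ∂P := by
    refine integral_mono (hf.integrable_stoppedValue hτ hτM)
      (hint.sub ((integrable_const _).indicator hSm)) fun ω => ?_
    by_cases hω : ω ∈ S
    · obtain ⟨i, hi, hfi⟩ := id hω
      have := stoppedValue_hittingBtwn_mem (u := f) (s := Set.Iic (-(c : ℝ))) (n := 0) (m := M)
        ⟨i, ⟨i.zero_le, hi⟩, hfi⟩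
      simp only [Set.indicator_of_mem hω]
      have hnn := posPart_nonneg (f M ω)
      refine le_trans (Set.mem_Iic.1 this) ?_
      linarith
    · have : hittingBtwn f (Set.Iic (-(c : ℝ))) 0 M ω = M := by
        rw [hittingBtwn, if_neg]
        rintro ⟨i, hi, hfi⟩
        exact hω ⟨i, hi.2, hfi⟩
      simp only [Set.indicator_of_notMem hω, stoppedValue, this, sub_zero]
      exact le_posPart (f M ω)
  rw [integral_sub hint ((integrable_const _).indicator hSm), integral_indicator_const _ hSm,
    smul_eq_mul, mul_comm] at h1
  linarith

/-- A maximal inequality for the absolute value of a discrete submartingale. -/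
theorem mul_measureReal_exists_le_abs_le (hf : Submartingale f 𝓖 P) (c : ℝ≥0) (M : ℕ) :
    c * P.real {ω | ∃ i ≤ M, (c : ℝ) ≤ |f i ω|} ≤
      2 * ∫ ω, (f M ω)⁺ ∂P - ∫ ω, f 0 ω ∂P := by
  have h : P.real {ω | ∃ i ≤ M, (c : ℝ) ≤ |f i ω|} ≤
      P.real {ω | ∃ i ≤ M, (c : ℝ) ≤ f i ω} + P.real {ω | ∃ i ≤ M, f i ω ≤ -(c : ℝ)} := by
    refine le_trans (measureReal_mono ?_) (measureReal_union_le _ _)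
    rintro ω ⟨i, hi, h⟩
    rcases le_abs.1 h with h | h
    · exact Or.inl ⟨i, hi, h⟩
    · exact Or.inr ⟨i, hi, by linarith⟩
  have := mul_le_mul_of_nonneg_left h c.2
  have h1 := mul_measureReal_exists_le_le hf c M
  have h2 := mul_measureReal_exists_le_neg_le hf c M
  rw [NNReal.val_eq_coe] at this
  linarith

/-- If the events `A n k` have probability at most `C / n`, uniformly in `k`, then outside a null
set, for some `n` the event `A n k` fails for infinitely many `k`. -/
theorem exists_null_of_mul_measureReal_le {m : MeasurableSpace Ω}
    {A : ℕ → ℕ → Set Ω} (hA : ∀ n k, MeasurableSet[m] (A n k)) {C : ℝ}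
    (hC : ∀ n k, n * P.real (A n k) ≤ C) :
    ∃ B, MeasurableSet[m] B ∧ P B = 0 ∧ ∀ ω ∉ B, ∃ n, ∃ᶠ k in atTop, ω ∉ A n k := by
  -- The lower limit in `k` inherits the bound `C / n` with no monotonicity of `A n k` in `k`.
  refine ⟨⋂ n, ⋃ j, ⋂ k ≥ j, A n k, ?_, ?_, ?_⟩
  · exact MeasurableSet.iInter fun n => MeasurableSet.iUnion fun j => MeasurableSet.iInter fun k =>
      MeasurableSet.iInter fun _ => hA n k
  · have hle : ∀ n : ℕ, n * P.real (⋂ n, ⋃ j, ⋂ k ≥ j, A n k) ≤ C := by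
      intro n
      have hmono : Monotone fun j => ⋂ k ≥ j, A n k := fun i j hij =>
        Set.biInter_subset_biInter_left fun k hk => le_trans hij hk
      have ht := tendsto_measure_iUnion_atTop (μ := P) hmono
      have ht' : Tendsto (fun j => (n : ℝ) * P.real (⋂ k ≥ j, A n k)) atTop
          (𝓝 (n * P.real (⋃ j, ⋂ k ≥ j, A n k))) :=
        ((ENNReal.tendsto_toReal (measure_ne_top _ _)).comp ht).const_mul _
      refine le_trans (mul_le_mul_of_nonneg_left
        (measureReal_mono (Set.iInter_subset _ n)) (Nat.cast_nonneg _))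
        (le_of_tendsto' ht' fun j => ?_)
      exact le_trans (mul_le_mul_of_nonneg_left
        (measureReal_mono (Set.biInter_subset_of_mem (Set.mem_Ici.2 le_rfl)))
        (Nat.cast_nonneg _)) (hC n j)
    rw [← measureReal_eq_zero_iff]
    by_contra hne
    have hpos := lt_of_le_of_ne measureReal_nonneg (Ne.symm hne)
    obtain ⟨n, hn⟩ := exists_nat_gt (C / P.real (⋂ n, ⋃ j, ⋂ k ≥ j, A n k))
    rw [div_lt_iff₀ hpos] at hn
    exact absurd (hle n) (not_le.2 hn)
  · intro ω hω
    simp only [Set.mem_iInter, Set.mem_iUnion, not_forall, not_exists] at hω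
    obtain ⟨n, hn⟩ := hω
    refine ⟨n, frequently_atTop.2 fun j => ?_⟩
    obtain ⟨k, hk, h⟩ := hn j
    exact ⟨k, hk, h⟩

end Discrete

/-! ### From finite grids to all rational times. -/

section Discretization

open scoped Nat

variable {Ω : Type*} {mΩ : MeasurableSpace Ω}

/-- The grid of times `i / k!`, stopped at time `N`. -/
noncomputable def gridTime (N k i : ℕ) : ℝ≥0 := min ((i : ℝ≥0) / (k ! : ℝ≥0)) N

theorem gridTime_mono (N k : ℕ) : Monotone (gridTime N k) := fun i j hij => by
  unfold gridTime
  gcongr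

theorem gridTime_zero (N k : ℕ) : gridTime N k 0 = 0 := by simp [gridTime]

theorem gridTime_le (N k i : ℕ) : gridTime N k i ≤ N := min_le_right _ _

/-- The horizon lies one index beyond the first arrival at `N`, so that a crossing completed at
index `N * k !` is still strictly before it. -/
theorem gridTime_end (N k : ℕ) : gridTime N k (N * k ! + 1) = N := by
  refine min_eq_right ?_
  rw [le_div_iff₀ (by positivity)]
  push_cast
  exact le_self_add

/-- The index on the `k`-th grid of a rational time. -/
def gridIndex (k : ℕ) (q : ℚ≥0) : ℕ := ⌊q * (k ! : ℚ≥0)⌋₊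

theorem gridIndex_mono (k : ℕ) : Monotone (gridIndex k) := fun p q hpq => by
  unfold gridIndex
  gcongr

theorem gridIndex_le {N k : ℕ} {q : ℚ≥0} (hq : (q : ℝ≥0) ≤ N) : gridIndex k q ≤ N * k ! := by
  refine Nat.floor_le_of_le ?_
  push_cast
  have : q ≤ (N : ℚ≥0) := by exact_mod_cast hq
  gcongr

/-- Factorial meshes put a rational `q` on every grid with `k ≥ q.den`. -/
theorem eventually_gridTime_gridIndex {N : ℕ} {q : ℚ≥0} (hq : (q : ℝ≥0) ≤ N) :
    ∀ᶠ k in atTop, gridTime N k (gridIndex k q) = q := by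
  filter_upwards [eventually_ge_atTop q.den] with k hk
  obtain ⟨c, hc⟩ := Nat.dvd_factorial q.den_pos hk
  have h1 : q * (k ! : ℚ≥0) = ((q.num * c : ℕ) : ℚ≥0) := by
    rw [hc]
    push_cast
    rw [← mul_assoc, NNRat.mul_den_eq_num]
  have h2 : ((gridIndex k q : ℕ) : ℚ≥0) = q * (k ! : ℚ≥0) := by
    rw [gridIndex, h1, Nat.floor_natCast]
  have h3 : ((gridIndex k q : ℕ) : ℝ≥0) = (q : ℝ≥0) * (k ! : ℝ≥0) := by exact_mod_cast h2
  rw [gridTime, h3, mul_div_cancel_right₀ _ (by positivity), min_eq_left hq]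

/-- The filtration sampled on a grid. -/
noncomputable def gridFiltration (𝓕 : Filtration ℝ≥0 mΩ) (N k : ℕ) : Filtration ℕ mΩ where
  seq i := 𝓕 (gridTime N k i)
  mono' _ _ hij := 𝓕.mono (gridTime_mono N k hij)
  le' _ := 𝓕.le _

theorem submartingale_grid {P : Measure Ω} {𝓕 : Filtration ℝ≥0 mΩ} {X : ℝ≥0 → Ω → ℝ}
    (hX : Submartingale X 𝓕 P) (N k : ℕ) :
    Submartingale (fun i => X (gridTime N k i)) (gridFiltration 𝓕 N k) P :=
  ⟨fun _ => hX.stronglyMeasurable _, fun _ _ hij => hX.2.1 _ _ (gridTime_mono N k hij),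
    fun _ => hX.integrable _⟩

variable {P : Measure Ω} [IsFiniteMeasure P] {𝓕 : Filtration ℝ≥0 mΩ} {X : ℝ≥0 → Ω → ℝ}

/-- The grid stops at `N`, so the events lie in `𝓕 N` and the maximal bound involves only times `0`
and `N`, whatever the mesh. -/
theorem exists_null_bounded (hX : Submartingale X 𝓕 P) (N : ℕ) :
    ∃ B, MeasurableSet[𝓕 N] B ∧ P B = 0 ∧
      ∀ ω ∉ B, ∃ C : ℝ, ∀ q : ℚ≥0, (q : ℝ≥0) ≤ N → |X q ω| ≤ C := by
  have key := exists_null_of_mul_measureReal_le (P := P) (m := 𝓕 N)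
    (A := fun n k => {ω | ∃ i ≤ N * k ! + 1, ((n : ℝ≥0) : ℝ) ≤ |X (gridTime N k i) ω|})
    (C := 2 * ∫ ω, (X N ω)⁺ ∂P - ∫ ω, X 0 ω ∂P)
  refine (key ?_ ?_).imp fun B ⟨hB, hB0, h⟩ => ⟨hB, hB0, fun ω hω => ?_⟩
  · intro n k
    have : {ω | ∃ i ≤ N * k ! + 1, ((n : ℝ≥0) : ℝ) ≤ |X (gridTime N k i) ω|} =
        ⋃ i ∈ Set.Iic (N * k ! + 1), {ω | ((n : ℝ≥0) : ℝ) ≤ |X (gridTime N k i) ω|} := by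
      ext; simp
    rw [this]
    refine MeasurableSet.biUnion (Set.to_countable _) fun i _ => ?_
    have hm : Measurable[𝓕 N] fun ω => |X (gridTime N k i) ω| :=
      continuous_abs.measurable.comp
        ((hX.stronglyMeasurable _).mono (𝓕.mono (gridTime_le N k i))).measurable
    exact hm measurableSet_Ici
  · intro n k
    have := mul_measureReal_exists_le_abs_le (submartingale_grid hX N k) n (N * k ! + 1)
    rw [gridTime_end, gridTime_zero] at this
    exact_mod_cast this
  · obtain ⟨n, hn⟩ := h ω hω
    refine ⟨n, fun q hq => ?_⟩
    obtain ⟨k, hk, hkq⟩ := (hn.and_eventually (eventually_gridTime_gridIndex hq)).exists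
    by_contra hlt
    refine hk ⟨gridIndex k q, (gridIndex_le hq).trans (Nat.le_succ _), ?_⟩
    rw [hkq]
    exact_mod_cast (not_le.1 hlt).le

theorem exists_null_upcrossings (hX : Submartingale X 𝓕 P) (N : ℕ) {a b : ℝ} (hab : a < b) :
    ∃ B, MeasurableSet[𝓕 N] B ∧ P B = 0 ∧
      ∀ ω ∉ B, ∃ n, ∀ u v : ℚ≥0, (v : ℝ≥0) ≤ N →
        ¬ UpcrossingChain a b (fun q : ℚ≥0 => X q ω) n u v := by
  have key := exists_null_of_mul_measureReal_le (P := P) (m := 𝓕 N)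
    (A := fun n k => {ω | upperCrossingTime a b (fun i => X (gridTime N k i)) (N * k ! + 1) n ω <
      N * k ! + 1})
    (C := (∫ ω, (X N ω - a)⁺ ∂P) / (b - a))
  refine (key ?_ ?_).imp fun B ⟨hB, hB0, h⟩ => ⟨hB, hB0, fun ω hω => ?_⟩
  · intro n k
    have h1 := (submartingale_grid hX N k).stronglyAdapted.isStoppingTime_upperCrossingTime
      (a := a) (b := b) (N := N * k ! + 1) (n := n) |>.measurableSet_lt_of_pred (N * k ! + 1)
    have h2 := (𝓕.mono (gridTime_le N k (N * k ! + 1))) _ h1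
    simpa only [ENat.some_eq_natCast, Nat.cast_lt] using! h2
  · intro n k
    have := mul_measureReal_upperCrossingTime_lt_le (submartingale_grid hX N k) hab
      (N * k ! + 1) n
    rwa [gridTime_end] at this
  · obtain ⟨n, hn⟩ := h ω hω
    refine ⟨n, fun u v hv hc => ?_⟩
    have hc' := hc.eventually_map (e := gridIndex) gridIndex_mono
      (f := fun k i => X (gridTime N k i) ω) fun s hs => by
        have hsN : (s : ℝ≥0) ≤ N := le_trans (by exact_mod_cast hs) hv
        exact (eventually_gridTime_gridIndex hsN).mono fun k hk => by simp only [hk]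
    obtain ⟨k, hk, hck⟩ := (hn.and_eventually hc').exists
    refine hk (lt_of_le_of_lt ?_ (Nat.lt_succ_of_le (gridIndex_le hv)))
    have := hck.upperCrossingTime_le (f := fun i => X (gridTime N k i)) (M := N * k ! + 1) (m := 0)
      ((gridIndex_le hv).trans (Nat.le_succ _)) (Nat.zero_le _)
    rwa [zero_add] at this

/-- Outside a null event of `𝓕 N`, the paths of a submartingale are tame up to time `N`. -/
theorem exists_null_isTameUpTo (hX : Submartingale X 𝓕 P) (N : ℕ) :
    ∃ B, MeasurableSet[𝓕 N] B ∧ P B = 0 ∧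
      ∀ ω ∉ B, IsTameUpTo (fun q : ℚ≥0 => X q ω) N := by
  obtain ⟨B, hB, hB0, h⟩ := exists_null_bounded hX N
  have H : ∀ p : {p : ℚ × ℚ // p.1 < p.2}, ∃ B, MeasurableSet[𝓕 N] B ∧ P B = 0 ∧
      ∀ ω ∉ B, ∃ n, ∀ u v : ℚ≥0, (v : ℝ≥0) ≤ N →
        ¬ UpcrossingChain (p.1.1 : ℝ) p.1.2 (fun q : ℚ≥0 => X q ω) n u v :=
    fun p => exists_null_upcrossings hX N (by exact_mod_cast p.2)
  choose B' hB' hB'0 h' using H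
  refine ⟨B ∪ ⋃ p, B' p, hB.union (MeasurableSet.iUnion hB'),
    measure_union_null hB0 (measure_iUnion_null hB'0), fun ω hω => ?_⟩
  rw [Set.mem_union, Set.mem_iUnion, not_or, not_exists] at hω
  exact ⟨h ω hω.1, fun a b hab => h' ⟨(a, b), hab⟩ ω (hω.2 _)⟩

end Discretization

/-! ### Uniform integrability and the càdlàg modification. -/

section RightLimits

variable {Ω : Type*} {mΩ : MeasurableSpace Ω} {P : Measure Ω} [IsFiniteMeasure P]
  {𝓕 : Filtration ℝ≥0 mΩ} {X : ℝ≥0 → Ω → ℝ}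

theorem integral_mono_of_submartingale (hX : Submartingale X 𝓕 P) {s t : ℝ≥0} (hst : s ≤ t) :
    ∫ ω, X s ω ∂P ≤ ∫ ω, X t ω ∂P := by
  simpa using hX.setIntegral_le hst MeasurableSet.univ

/-- The difference has constant sign a.s., so its L¹ norm is the gap between the means. -/
theorem eLpNorm_sub_condExp_eq (hX : Submartingale X 𝓕 P) {s t : ℝ≥0} (hst : s ≤ t) :
    eLpNorm (X s - P[X t | 𝓕 s]) 1 P = ENNReal.ofReal (∫ ω, X t ω ∂P - ∫ ω, X s ω ∂P) := by
  rw [eLpNorm_one_eq_lintegral_enorm,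
    ← ofReal_integral_norm_eq_lintegral_enorm ((hX.integrable s).sub integrable_condExp)]
  congr 1
  rw [← integral_condExp (𝓕.le s) (f := X t), ← integral_sub integrable_condExp (hX.integrable s)]
  refine integral_congr_ae ?_
  filter_upwards [hX.ae_le_condExp hst] with ω hω
  rw [Pi.sub_apply, Real.norm_eq_abs, abs_sub_comm, abs_of_nonneg (sub_nonneg.2 hω)]

/-- Along times decreasing to a point of right-continuity of its mean, a submartingale is
uniformly integrable. -/
theorem unifIntegrable_of_tendsto_nhdsGT (hX : Submartingale X 𝓕 P) {t : ℝ≥0}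
    (hmean : ContinuousWithinAt (fun s => ∫ ω, X s ω ∂P) (Set.Ici t) t) {q : ℕ → ℝ≥0}
    (hq : Tendsto q atTop (𝓝[>] t)) : UnifIntegrable (fun n => X (q n)) 1 P := by
  intro ε hε
  have hε2 : 0 < ε / 2 := half_pos hε
  obtain ⟨T, hT, htT⟩ : ∃ T, ∫ ω, X T ω ∂P < ∫ ω, X t ω ∂P + ε / 2 ∧ t < T := by
    have h := hmean.tendsto.mono_left (nhdsWithin_mono t Set.Ioi_subset_Ici_self)
    exact ((h.eventually_lt_const (lt_add_of_pos_right _ hε2)).and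
      self_mem_nhdsWithin).exists
  obtain ⟨N, hN⟩ := eventually_atTop.1 (hq.eventually_mem (Ioc_mem_nhdsGT htT))
  obtain ⟨δ₁, hδ₁, h₁⟩ := ((hX.integrable T).uniformIntegrable_condExp
    (fun n => 𝓕.le (q n))).2.1 hε2
  obtain ⟨δ₂, hδ₂, h₂⟩ := unifIntegrable_finite (μ := P) (p := 1) le_rfl ENNReal.one_ne_top
    (f := fun n : Fin N => X (q n)) (fun n => memLp_one_iff_integrable.2 (hX.integrable _)) hε
  refine ⟨min δ₁ δ₂, lt_min hδ₁ hδ₂, fun n s hs hPs => ?_⟩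
  rcases lt_or_ge n N with hn | hn
  · exact h₂ ⟨n, hn⟩ s hs (hPs.trans (ENNReal.ofReal_le_ofReal (min_le_right _ _)))
  -- Since `t < q n ≤ T`, the first part has L¹ norm at most the mean gap between `t` and `T`, below
  -- `ε / 2`; the second belongs to a uniformly integrable family.
  have hsplit : s.indicator (X (q n)) =
      s.indicator (X (q n) - P[X T | 𝓕 (q n)]) + s.indicator (P[X T | 𝓕 (q n)]) := by
    rw [← Set.indicator_add', sub_add_cancel]
  have hd : eLpNorm (s.indicator (X (q n) - P[X T | 𝓕 (q n)])) 1 P ≤ ENNReal.ofReal (ε / 2) := by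
    refine (eLpNorm_indicator_le _).trans ?_
    rw [eLpNorm_sub_condExp_eq hX (hN n hn).2]
    refine ENNReal.ofReal_le_ofReal ?_
    linarith [integral_mono_of_submartingale hX (hN n hn).1.le]
  rw [hsplit]
  refine (eLpNorm_add_le
    (((hX.integrable _).sub integrable_condExp).indicator hs).aestronglyMeasurable
    (integrable_condExp.indicator hs).aestronglyMeasurable le_rfl).trans ?_
  refine (add_le_add hd (h₁ n s hs
    (hPs.trans (ENNReal.ofReal_le_ofReal (min_le_left _ _))))).trans ?_
  rw [← ENNReal.ofReal_add hε2.le hε2.le, add_halves]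

/-- Write `|x| = 2x⁺ - x`; the means of `X` and `X⁺` are both nondecreasing. -/
theorem integral_norm_le_of_submartingale (hX : Submartingale X 𝓕 P) {r s t : ℝ≥0} (hrs : r ≤ s)
    (hst : s ≤ t) : ∫ ω, ‖X s ω‖ ∂P ≤ 2 * ∫ ω, (X t ω)⁺ ∂P - ∫ ω, X r ω ∂P := by
  have hpos : Integrable (fun ω => (X s ω)⁺) P := hX.pos.integrable s
  have h1 : ∫ ω, ‖X s ω‖ ∂P = 2 * ∫ ω, (X s ω)⁺ ∂P - ∫ ω, X s ω ∂P := by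
    rw [← integral_const_mul, ← integral_sub (hpos.const_mul 2) (hX.integrable s)]
    refine integral_congr_ae (ae_of_all _ fun ω => ?_)
    have h2 := posPart_sub_negPart (X s ω)
    have h3 := posPart_add_negPart (X s ω)
    simp only [Real.norm_eq_abs]
    linarith
  have h2 : ∫ ω, (X s ω)⁺ ∂P ≤ ∫ ω, (X t ω)⁺ ∂P := integral_mono_of_submartingale hX.pos hst
  linarith [integral_mono_of_submartingale hX hrs]

/-- The right limit of a submartingale at a point of right-continuity of its mean agrees almost
surely with its value there, provided that it is measurable at that time. -/
theorem ae_eq_of_tendsto_nhdsGT (hX : Submartingale X 𝓕 P) {t : ℝ≥0}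
    (hmean : ContinuousWithinAt (fun s => ∫ ω, X s ω ∂P) (Set.Ici t) t) {q : ℕ → ℝ≥0}
    (hq : Tendsto q atTop (𝓝[>] t)) {Y : Ω → ℝ} (hY : StronglyMeasurable[𝓕 t] Y)
    (hlim : ∀ᵐ ω ∂P, Tendsto (fun n => X (q n) ω) atTop (𝓝 (Y ω))) : Y =ᵐ[P] X t := by
  have hev : ∀ᶠ n in atTop, q n ∈ Set.Ioc t (t + 1) :=
    hq.eventually_mem (Ioc_mem_nhdsGT (lt_add_one t))
  have hYint : Integrable Y P := by
    refine memLp_one_iff_integrable.1 ⟨(hY.mono (𝓕.le t)).aestronglyMeasurable, ?_⟩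
    refine lt_of_le_of_lt (Lp.eLpNorm_lim_le_liminf_eLpNorm
      (fun n => (hX.integrable (q n)).aestronglyMeasurable) Y hlim) ?_
    refine lt_of_le_of_lt ?_ (ENNReal.ofReal_lt_top
      (r := 2 * ∫ ω, (X (t + 1) ω)⁺ ∂P - ∫ ω, X t ω ∂P))
    refine liminf_le_of_frequently_le' (hev.mono fun n hn => ?_).frequently
    rw [eLpNorm_one_eq_lintegral_enorm, ← ofReal_integral_norm_eq_lintegral_enorm (hX.integrable _)]
    exact ENNReal.ofReal_le_ofReal (integral_norm_le_of_submartingale hX hn.1.le hn.2)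
  have hL1 := tendsto_Lp_finite_of_tendsto_ae le_rfl ENNReal.one_ne_top
    (fun n => (hX.integrable (q n)).aestronglyMeasurable) (memLp_one_iff_integrable.2 hYint)
    (unifIntegrable_of_tendsto_nhdsGT hX hmean hq) hlim
  have hset : ∀ s, Tendsto (fun n => ∫ ω in s, X (q n) ω ∂P) atTop (𝓝 (∫ ω in s, Y ω ∂P)) :=
    fun s => tendsto_setIntegral_of_L1' Y hYint.aestronglyMeasurable
      (Eventually.of_forall fun n => hX.integrable (q n)) hL1 s
  have hle : X t ≤ᵐ[P] Y := by
    -- Both sides are `𝓕 t`-measurable, so testing on sets of `𝓕 t`, where the submartingale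
    -- inequality applies, suffices.
    refine ae_le_of_ae_le_trim (hm := 𝓕.le t) ?_
    refine ae_le_of_forall_setIntegral_le
      ((hX.integrable t).trim (𝓕.le t) (hX.stronglyMeasurable t)) (hYint.trim (𝓕.le t) hY) ?_
    intro s hs _
    rw [← setIntegral_trim (𝓕.le t) (hX.stronglyMeasurable t) hs,
      ← setIntegral_trim (𝓕.le t) hY hs]
    exact ge_of_tendsto (hset s) (hev.mono fun n hn => hX.setIntegral_le hn.1.le hs)
  refine ((integral_eq_iff_of_ae_le (hX.integrable t) hYint hle).1 ?_).symm
  refine tendsto_nhds_unique ((hmean.tendsto.mono_left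
    (nhdsWithin_mono t Set.Ioi_subset_Ici_self)).comp hq) ?_
  simpa [Function.comp_def] using hset Set.univ

/-- Under the N-usual conditions, a submartingale with right-continuous mean has an adapted càdlàg
modification. -/
theorem exists_isCadlagModification_of_submartingale (h𝓕 : NUsualConditions 𝓕 P)
    (hX : Submartingale X 𝓕 P)
    (hmean : ∀ t : ℝ≥0, ContinuousWithinAt (fun s => ∫ ω, X s ω ∂P) (Set.Ici t) t) :
    ∃ Y : ℝ≥0 → Ω → ℝ, IsCadlagModification P Y X ∧ StronglyAdapted 𝓕 Y := by
  choose B' hB' hB'0 htame' using exists_null_isTameUpTo hX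
  set B := ⋃ N, B' N
  have hB : MeasurableSet[𝓕 0] B :=
    h𝓕.nComplete B ⟨B', fun n => ⟨hB' n, hB'0 n⟩, le_rfl⟩
  have hB0 : P B = 0 := measure_iUnion_null hB'0
  have htame : ∀ ω ∉ B, ∀ N, IsTameUpTo (fun q : ℚ≥0 => X q ω) N := fun ω hω N =>
    htame' N ω fun h => hω (Set.mem_iUnion.2 ⟨N, h⟩)
  have hseq : ∀ t, ∃ q : ℕ → ℚ≥0, Tendsto q atTop (rightRat t) := fun t =>
    exists_seq_tendsto (rightRat t)
  let Y : ℝ≥0 → Ω → ℝ := fun t =>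
    Bᶜ.indicator fun ω => limUnder (rightRat t) fun q : ℚ≥0 => X q ω
  have hYB : ∀ t, ∀ ω ∈ B, Y t ω = 0 := fun t ω hω =>
    Set.indicator_of_notMem (Set.notMem_compl_iff.2 hω) _
  have hYlim : ∀ ω ∉ B, ∀ t, Tendsto (fun q : ℚ≥0 => X q ω) (rightRat t) (𝓝 (Y t ω)) := by
    intro ω hω t
    have : Y t ω = limUnder (rightRat t) fun q : ℚ≥0 => X q ω :=
      Set.indicator_of_mem (Set.mem_compl hω) _
    rw [this]
    exact tendsto_nhds_limUnder (exists_tendsto_rightRat (htame ω hω) t)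
  have hY_lt : ∀ t u, t < u → Measurable[𝓕 u] (Y t) := by
    intro t u htu
    obtain ⟨q, hq⟩ := hseq t
    -- Capping at `u` makes every term `𝓕 u`-measurable without changing the limit, since eventually
    -- `q n < u`.
    refine (stronglyMeasurable_of_tendsto (m := 𝓕 u) atTop
      (f := fun n => Bᶜ.indicator (X (min (q n) u))) (fun n => ?_) ?_).measurable
    · exact ((hX.stronglyMeasurable _).mono (𝓕.mono (min_le_right _ _))).indicator
        (𝓕.mono zero_le _ hB.compl)
    · refine tendsto_pi_nhds.2 fun ω => ?_
      by_cases hω : ω ∈ B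
      · rw [hYB t ω hω]
        simp [Set.indicator_of_notMem (Set.notMem_compl_iff.2 hω)]
      · refine ((hYlim ω hω t).comp hq).congr' ?_
        have hev : ∀ᶠ p : ℚ≥0 in rightRat t, (p : ℝ≥0) < u :=
          eventually_rightRat.2 ⟨u, htu, fun _ _ h => h⟩
        filter_upwards [hq.eventually hev] with n hn
        rw [Set.indicator_of_mem (Set.mem_compl hω), min_eq_left hn.le, Function.comp_apply]
  have hYad : StronglyAdapted 𝓕 Y := by
    intro t
    refine Measurable.stronglyMeasurable fun s hs => ?_
    refine h𝓕.rightContinuous.RC t _ ?_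
    rw [Filtration.rightCont_eq]
    simp only [MeasurableSpace.measurableSet_iInf]
    exact fun u hu => hY_lt t u hu hs
  refine ⟨Y, ⟨fun t => ?_, fun ω => ?_⟩, hYad⟩
  · obtain ⟨q, hq⟩ := hseq t
    refine ae_eq_of_tendsto_nhdsGT hX (hmean t) (q := fun n => (q n : ℝ≥0))
      (tendsto_comap.comp hq) (hYad t) ?_
    filter_upwards [compl_mem_ae_iff.2 hB0] with ω hω
    exact (hYlim ω hω t).comp hq
  · by_cases hω : ω ∈ B
    · simp only [hYB _ ω hω]
      exact fun t => ⟨continuousWithinAt_const, 0, tendsto_const_nhds⟩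
    · exact isCadlag_of_tendsto_rightRat (hYlim ω hω) (exists_tendsto_leftRat (htame ω hω))

end RightLimits

theorem indistinguishable_of_isCadlagModification {Ω : Type*} {mΩ : MeasurableSpace Ω}
    {P : Measure Ω} {X Y Z : ℝ≥0 → Ω → ℝ}
    (hY : IsCadlagModification P Y X) (hZ : IsCadlagModification P Z X) :
    Indistinguishable P Y Z := by
  have hY' : ∀ᵐ ω ∂P, ∀ q : ℚ≥0, Y q ω = X q ω := ae_all_iff.2 fun q => hY.1 q
  have hZ' : ∀ᵐ ω ∂P, ∀ q : ℚ≥0, Z q ω = X q ω := ae_all_iff.2 fun q => hZ.1 q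
  filter_upwards [hY', hZ'] with ω h1 h2
  exact (hY.2 ω).eq_of_forall_nnrat (hZ.2 ω) fun q => (h1 q).trans (h2 q).symm

theorem IsCadlag.neg {f : ℝ≥0 → ℝ} (hf : IsCadlag f) : IsCadlag fun t => -f t := fun t =>
  ⟨(hf t).1.neg, (hf t).2.imp' Neg.neg fun _ h => h.neg⟩

end NAugmentation

theorem mainTheorem6 {Ω : Type*} {mΩ : MeasurableSpace Ω}
    (P : Measure Ω) [IsProbabilityMeasure P] (𝓕 : Filtration ℝ≥0 mΩ)
    (h𝓕 : NAugmentation.NUsualConditions 𝓕 P) (X : ℝ≥0 → Ω → ℝ)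
    (hX : ((Submartingale X 𝓕 P ∨ Supermartingale X 𝓕 P) ∧
        ∀ t : ℝ≥0, ContinuousWithinAt (fun s => ∫ ω, X s ω ∂P) (Set.Ici t) t) ∨
      Martingale X 𝓕 P) :
    (∃ Y : ℝ≥0 → Ω → ℝ, NAugmentation.IsCadlagModification P Y X ∧ StronglyAdapted 𝓕 Y) ∧
    (∀ Y Z : ℝ≥0 → Ω → ℝ,
      NAugmentation.IsCadlagModification P Y X → NAugmentation.IsCadlagModification P Z X →
        NAugmentation.Indistinguishable P Y Z) := by
  refine ⟨?_, fun Y Z => NAugmentation.indistinguishable_of_isCadlagModification⟩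
  rcases hX with ⟨hX | hX, hmean⟩ | hX
  · exact NAugmentation.exists_isCadlagModification_of_submartingale h𝓕 hX hmean
  · obtain ⟨Y, ⟨hmod, hcad⟩, had⟩ :=
      NAugmentation.exists_isCadlagModification_of_submartingale h𝓕 hX.neg fun t => by
        simp only [Pi.neg_apply, integral_neg]
        exact (hmean t).neg
    refine ⟨-Y, ⟨fun t => ?_, fun ω => (hcad ω).neg⟩, had.neg⟩
    filter_upwards [hmod t] with ω hω
    rw [Pi.neg_apply, Pi.neg_apply, hω, Pi.neg_apply, Pi.neg_apply, neg_neg]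
  · refine NAugmentation.exists_isCadlagModification_of_submartingale h𝓕 hX.submartingale
      fun t => ?_
    have hconst : ∀ s, ∫ ω, X s ω ∂P = ∫ ω, X 0 ω ∂P := fun s => by
      simpa using (hX.setIntegral_eq (zero_le (a := s)) MeasurableSet.univ).symm
    simp only [hconst]
    exact continuousWithinAt_const
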